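/- Let $N$ be a positive integer. For $x\in\mathbb R^N$ let $P_x=|Fx|^2\in\mathbb R^N_{\ge 0}$ (componentwise squared absolute value) be its power spectrum, where $F=(\omega^{kn})_{0\le k,n<N}$, $\omega=e^{2\pi i/N}$, is the discrete Fourier transform matrix; for a linear subspace $W\subset\mathbb R^N$ let $P_W=\{P_x : x\in W\}$. For an ordered basis $\mathbb V=(v_1,\dots,v_N)$ of $\mathbb R^N$ and $S\subset\{1,\dots,N\}$ put $\mathbb L_S(\mathbb V)=\mathrm{span}(v_i : i\in S)$. A property holds for a generic point of an irreducible real variety $X$ if it holds on a non-empty Zariski open subset of $X$; bases of $\mathbb R^N$ are regarded as points of $\mathrm{GL}(N,\mathbb R)\subset\mathbb R^{N\times N}$. For an integer $M\ge 0$ consider the following conditions on $\mathbb V$. - (SR1) For all $S$ with $|S|=M$ and all $x,y\in\mathbb L_S(\mathbb V)$: $P_x=P_y$ if and only if $x=\pm y$. - (SR2) For all distinct $S_1,S_2$ with $|S_1|=|S_2|=M$: $P_{\mathbb L_{S_1}(\mathbb V)}\cap P_{\mathbb L_{S_2}(\mathbb V)}=P_{\mathbb L_{S_1}(\mathbb V)\cap\mathbb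 L_{S_2}(\mathbb V)}$. - (SR1g) For all $S$ with $|S|=M$ and generic $x\in\mathbb L_S(\mathbb V)$: for every $y\in\mathbb L_S(\mathbb V)$, $P_x=P_y$ if and only if $x=\pm y$. - (SR2g) For all distinct $S_1,S_2$ with $|S_1|=|S_2|=M$: $P_{\mathbb L_{S_1}(\mathbb V)}\cap P_{\mathbb L_{S_2}(\mathbb V)}$ is contained in a proper real-algebraic subset of $P_{\mathbb L_{S_1}(\mathbb V)}$, that is, in $P_{\mathbb L_{S_1}(\mathbb V)}\cap Z$ for some real algebraic set $Z\subset\mathbb R^N$ with $P_{\mathbb L_{S_1}(\mathbb V)}\not\subset Z$. **Theorem.** Let $\mathbb V$ be a generic basis of $\mathbb R^N$. Then for every $M\ge 0$: (i) (SR1) holds if $N>4M-6$ ($N$ even) or $N>4M-5$ ($N$ odd), and (SR2) holds if $N>4M-4$ ($N$ even) or $N>4M-3$ ($N$ odd). (ii) (SR1g) and (SR2g) hold if $N>2M-2$ ($N$ even) or $N>2M-1$ ($N$ odd). -/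

import Mathlib

namespace SparsePhase

/-- A subset of the affine space `ℝ^σ` is real algebraic (Zariski closed) if it is the common
zero set of some real polynomials. -/
def IsRealAlgebraic {σ : Type*} (Z : Set (σ → ℝ)) : Prop :=
  ∃ I : Ideal (MvPolynomial σ ℝ), Z = MvPolynomial.zeroLocus ℝ I

/-- A property holds generically on `X ⊆ ℝ^σ` if it holds at every point of some non-empty
(relatively) Zariski open subset `X \ Z` of `X`. -/
def HoldsGenerically {σ : Type*} (X : Set (σ → ℝ)) (p : (σ → ℝ) → Prop) : Prop :=
  ∃ Z : Set (σ → ℝ), IsRealAlgebraic Z ∧ (X \ Z).Nonempty ∧ ∀ x ∈ X \ Z, p x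

/-- The `N × N` discrete Fourier transform matrix `(ω^(kn))`, `0 ≤ k, n < N`,
with `ω = exp(2πi/N)`. -/
noncomputable def dftMatrix (N : ℕ) : Matrix (Fin N) (Fin N) ℂ :=
  Matrix.of fun k n => Complex.exp (2 * Real.pi * Complex.I / N) ^ ((k : ℕ) * (n : ℕ))

/-- The power spectrum `P_x = |F x|²` (componentwise) of a real vector. -/
noncomputable def powerSpectrum {N : ℕ} (x : Fin N → ℝ) : Fin N → ℝ :=
  fun k => ‖((dftMatrix N).mulVec fun n => (x n : ℂ)) k‖ ^ 2

/-- The set of ordered bases of `ℝ^N`, inside the affine space of all `N`-tuples of vectors of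
`ℝ^N`: the entry `A (i, j)` is the `j`-th coordinate of the `i`-th vector. -/
def bases (N : ℕ) : Set (Fin N × Fin N → ℝ) :=
  {A | LinearIndependent ℝ (Function.curry A) ∧
    Submodule.span ℝ (Set.range (Function.curry A)) = ⊤}

/-- A property holds for a generic (ordered) basis of `ℝ^N`. -/
def ForGenericBasis (N : ℕ) (p : (Fin N → Fin N → ℝ) → Prop) : Prop :=
  HoldsGenerically (bases N) fun A => p (Function.curry A)

/-- `L_S(V)`, the span of the vectors `v_i`, `i ∈ S`. -/
def L {N : ℕ} (V : Fin N → Fin N → ℝ) (S : Finset (Fin N)) : Submodule ℝ (Fin N → ℝ) :=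
  Submodule.span ℝ (V '' (S : Set (Fin N)))

/-- The image `P_W` of a linear subspace `W` under the power spectrum map. -/
def specImage {N : ℕ} (W : Submodule ℝ (Fin N → ℝ)) : Set (Fin N → ℝ) :=
  powerSpectrum '' (W : Set (Fin N → ℝ))

/-- `x = t y` for some `t ∈ S¹ ∩ ℝ`. -/
def EqUpToSign {N : ℕ} (x y : Fin N → ℝ) : Prop :=
  ∃ t : ℝ, ‖t‖ = 1 ∧ x = t • y

/-- Two vectors with the same support of size `M` and the same power spectrum agree up to sign. -/
def SR1 {N : ℕ} (V : Fin N → Fin N → ℝ) (M : ℕ) : Prop :=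
  ∀ S : Finset (Fin N), S.card = M → ∀ x ∈ L V S, ∀ y ∈ L V S,
    (powerSpectrum x = powerSpectrum y ↔ EqUpToSign x y)

/-- Power spectra common to two different supports come from the common subspace. -/
def SR2 {N : ℕ} (V : Fin N → Fin N → ℝ) (M : ℕ) : Prop :=
  ∀ S₁ S₂ : Finset (Fin N), S₁.card = M → S₂.card = M → S₁ ≠ S₂ →
    specImage (L V S₁) ∩ specImage (L V S₂) = specImage (L V S₁ ⊓ L V S₂)

/-- The generic version of `SR1`. -/
def SR1g {N : ℕ} (V : Fin N → Fin N → ℝ) (M : ℕ) : Prop :=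
  ∀ S : Finset (Fin N), S.card = M →
    HoldsGenerically (L V S : Set (Fin N → ℝ)) fun x =>
      ∀ y ∈ L V S, (powerSpectrum x = powerSpectrum y ↔ EqUpToSign x y)

/-- The generic version of `SR2`: for distinct supports, `P_{L_{S₁}} ∩ P_{L_{S₂}}` lies in a
proper real algebraic subset `P_{L_{S₁}} ∩ Z` of `P_{L_{S₁}}`. -/
def SR2g {N : ℕ} (V : Fin N → Fin N → ℝ) (M : ℕ) : Prop :=
  ∀ S₁ S₂ : Finset (Fin N), S₁.card = M → S₂.card = M → S₁ ≠ S₂ →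
    ∃ Z : Set (Fin N → ℝ), IsRealAlgebraic Z ∧
      specImage (L V S₁) ∩ specImage (L V S₂) ⊆ specImage (L V S₁) ∩ Z ∧
      specImage (L V S₁) ∩ Z ⊂ specImage (L V S₁)

end SparsePhase

/-!
Two real vectors `x`, `y` have the same power spectrum if and only if the Fourier coefficients of
`x + y` and `x - y` are orthogonal in the plane at each frequency. As the Fourier coefficients of
real vectors are Hermitian, only the frequencies `0, …, ⌊N / 2⌋` matter; orthogonality is one
condition at each of them, so such pairs form a set of dimension `2N - (⌊N / 2⌋ + 1)`, which is
stable under scaling both components independently.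

Now count the bases `V` for which an independent pair `(u, w)` of this set has `u` in the span of
the `v_i`, `i ∈ S₁`, and `w` in the span of the `v_j`, `j ∈ S₂`. Two vectors of `V` are determined
by the remaining ones, the pair, and the coefficients, and the scalings make two of the coefficients
superfluous. For small `S₁` and `S₂` fewer than `N²` parameters are left, so the bases in question
satisfy a polynomial equation. This settles the case `S₁ = S₂`, with `u = x + y` and `w = x - y`.
For distinct supports, take `u = x` and `w = e • y`, at the cost of the parameter `e`.

For generic vectors, the same count bounds the dimension of the set of pairs `(V, x)` with `x` in
`L V S` colliding with another vector. The power spectra at `#S ≤ ⌊N / 2⌋ + 1` frequencies are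
algebraically independent on `L V S` for one basis `V`, hence for a generic one, and a set of fewer
than `#S` dimensions in each `L V S` then has an image on which some polynomial vanishes.
-/

namespace SparsePhase

section PolyMap

variable {K E F G : Type*} [Field K] [AddCommGroup E] [Module K E] [AddCommGroup F] [Module K F]
  [AddCommGroup G] [Module K G]

/-- The algebra of polynomial functions on a vector space, generated by the linear forms. -/
def polyFunctions (K E : Type*) [Field K] [AddCommGroup E] [Module K E] : Subalgebra K (E → K) :=
  Algebra.adjoin K (Set.range fun φ : Module.Dual K E => (φ : E → K))

variable (K) in
/-- Polynomial maps between vector spaces, without reference to bases: composing with any linear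
form gives a polynomial function. -/
@[fun_prop]
def IsPolyMap (f : E → F) : Prop :=
  ∀ φ : Module.Dual K F, (fun x => φ (f x)) ∈ polyFunctions K E

theorem isPolyMap_iff_mem {f : E → K} : IsPolyMap K f ↔ f ∈ polyFunctions K E := by
  refine ⟨fun hf => hf LinearMap.id, fun hf φ => ?_⟩
  have : (fun x => φ (f x)) = φ 1 • f := by
    funext x
    rw [Pi.smul_apply, smul_eq_mul, mul_comm, ← smul_eq_mul, ← map_smul, smul_eq_mul, mul_one]
  exact this ▸ Subalgebra.smul_mem _ hf _

namespace IsPolyMap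

variable {f g : E → F}

@[fun_prop]
theorem linearMap_apply (l : E →ₗ[K] F) : IsPolyMap K fun x => l x :=
  fun φ => Algebra.subset_adjoin ⟨φ.comp l, rfl⟩

@[fun_prop]
theorem id : IsPolyMap K fun x : E => x := linearMap_apply LinearMap.id

@[fun_prop]
theorem const (c : F) : IsPolyMap K fun _ : E => c :=
  fun φ => (polyFunctions K E).algebraMap_mem (φ c)

@[fun_prop]
theorem comp {g : F → G} {f : E → F} (hg : IsPolyMap K g) (hf : IsPolyMap K f) :
    IsPolyMap K fun x => g (f x) := by
  intro φ
  let pullback : (F → K) →ₐ[K] (E → K) := AlgHom.pi fun x => Pi.evalAlgHom K _ (f x)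
  have : polyFunctions K F ≤ (polyFunctions K E).comap pullback :=
    Algebra.adjoin_le (Set.range_subset_iff.2 hf)
  exact this (hg φ)

@[fun_prop]
theorem add (hf : IsPolyMap K f) (hg : IsPolyMap K g) : IsPolyMap K fun x => f x + g x :=
  fun φ => by simpa only [map_add] using! add_mem (hf φ) (hg φ)

@[fun_prop]
theorem sub (hf : IsPolyMap K f) (hg : IsPolyMap K g) : IsPolyMap K fun x => f x - g x :=
  fun φ => by simpa only [map_sub] using! sub_mem (hf φ) (hg φ)

@[fun_prop]
theorem smul {c : E → K} (hc : IsPolyMap K c) (hf : IsPolyMap K f) :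
    IsPolyMap K fun x => c x • f x := fun φ => by
  simpa only [map_smul] using! mul_mem (isPolyMap_iff_mem.1 hc) (hf φ)

@[fun_prop]
theorem mul {c d : E → K} (hc : IsPolyMap K c) (hd : IsPolyMap K d) :
    IsPolyMap K fun x => c x * d x := hc.smul hd

@[fun_prop]
theorem finset_sum {ι : Type*} {s : Finset ι} {f : ι → E → F} (hf : ∀ i, IsPolyMap K (f i)) :
    IsPolyMap K fun x => ∑ i ∈ s, f i x := fun φ => by
  simpa only [map_sum, Finset.sum_fn] using! sum_mem fun i (_ : i ∈ s) => hf i φ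

@[fun_prop]
theorem finset_prod {ι : Type*} {s : Finset ι} {c : ι → E → K} (hc : ∀ i, IsPolyMap K (c i)) :
    IsPolyMap K fun x => ∏ i ∈ s, c i x := isPolyMap_iff_mem.2 <| by
  simpa only [Finset.prod_fn] using! prod_mem fun i (_ : i ∈ s) => isPolyMap_iff_mem.1 (hc i)

@[fun_prop]
theorem fst {f : E → F × G} (hf : IsPolyMap K f) : IsPolyMap K fun x => (f x).1 :=
  (linearMap_apply (LinearMap.fst K F G)).comp hf

@[fun_prop]
theorem snd {f : E → F × G} (hf : IsPolyMap K f) : IsPolyMap K fun x => (f x).2 :=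
  (linearMap_apply (LinearMap.snd K F G)).comp hf

@[fun_prop]
theorem prodMk {g : E → G} (hf : IsPolyMap K f) (hg : IsPolyMap K g) :
    IsPolyMap K fun x => (f x, g x) := by
  have : (fun x => (f x, g x)) = fun x => LinearMap.inl K F G (f x) + LinearMap.inr K F G (g x) :=
    by simp
  rw [this]
  fun_prop

variable {ι : Type*} {M : ι → Type*} [∀ i, AddCommGroup (M i)] [∀ i, Module K (M i)]

@[fun_prop]
theorem apply (i : ι) : IsPolyMap K fun x : ∀ i, M i => x i :=
  linearMap_apply (LinearMap.proj i : (∀ i, M i) →ₗ[K] M i)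

@[fun_prop]
theorem pi [Finite ι] {f : E → ∀ i, M i} (hf : ∀ i, IsPolyMap K fun x => f x i) :
    IsPolyMap K f := by
  classical
  have := Fintype.ofFinite ι
  have : f = fun x => ∑ i, LinearMap.single K M i (f x i) := by
    funext x
    exact (LinearMap.sum_single_apply M (f x)).symm
  rw [this]
  fun_prop

@[fun_prop]
theorem eval (p : MvPolynomial ι K) : IsPolyMap K fun x => MvPolynomial.eval x p := by
  induction p using MvPolynomial.induction_on with
  | C c => simpa only [MvPolynomial.eval_C] using const c
  | add p q hp hq => simpa only [map_add] using hp.add hq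
  | mul_X p i hp => simpa only [map_mul, MvPolynomial.eval_X] using hp.mul (apply i)

theorem exists_mvPolynomial [Finite ι] (b : Module.Basis ι K E) {f : E → K} (hf : IsPolyMap K f) :
    ∃ p : MvPolynomial ι K, ∀ x, f x = MvPolynomial.eval (b.equivFun x) p := by
  have := Fintype.ofFinite ι
  let evalRepr : MvPolynomial ι K →ₐ[K] (E → K) := AlgHom.pi fun x =>
    MvPolynomial.aeval (b.equivFun x)
  suffices polyFunctions K E ≤ evalRepr.range by
    obtain ⟨p, hp⟩ := this (isPolyMap_iff_mem.1 hf)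
    exact ⟨p, fun x => (congrFun hp x).symm⟩
  refine Algebra.adjoin_le ?_
  rintro _ ⟨φ, rfl⟩
  refine ⟨∑ i, MvPolynomial.C (φ (b i)) * MvPolynomial.X i, funext fun x => ?_⟩
  change MvPolynomial.aeval (b.equivFun x) _ = φ x
  conv_rhs => rw [← b.sum_equivFun x]
  simp only [map_sum, map_smul, smul_eq_mul, map_mul, MvPolynomial.aeval_C,
    MvPolynomial.aeval_X, Algebra.algebraMap_self_apply, mul_comm]

theorem eq_zero_or_eq_zero_of_mul_eq_zero [Infinite K] [FiniteDimensional K E] {f g : E → K}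
    (hf : IsPolyMap K f) (hg : IsPolyMap K g) (h : ∀ x, f x * g x = 0) : f = 0 ∨ g = 0 := by
  let b := Module.finBasis K E
  obtain ⟨p, hp⟩ := hf.exists_mvPolynomial b
  obtain ⟨q, hq⟩ := hg.exists_mvPolynomial b
  have hpq : p * q = 0 := MvPolynomial.funext fun x => by
    simpa only [hp, hq, LinearEquiv.apply_symm_apply, map_mul, map_zero]
      using h (b.equivFun.symm x)
  rcases mul_eq_zero.1 hpq with rfl | rfl
  · exact Or.inl (funext fun x => by simp [hp])
  · exact Or.inr (funext fun x => by simp [hq])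

theorem det {n : Type*} [Fintype n] [DecidableEq n] :
    IsPolyMap K fun A : n → n → K => (Matrix.of A).det := by
  simp only [Matrix.det_apply', Matrix.of_apply]
  fun_prop

theorem analyticOnNhd {E F : Type*} [NormedAddCommGroup E] [NormedSpace ℝ E]
    [FiniteDimensional ℝ E] [NormedAddCommGroup F] [NormedSpace ℝ F] [FiniteDimensional ℝ F]
    {f : E → F} (hf : IsPolyMap ℝ f) : AnalyticOnNhd ℝ f Set.univ := by
  have scalar : ∀ g ∈ polyFunctions ℝ E, AnalyticOnNhd ℝ g Set.univ := by
    intro g hg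
    induction hg using Algebra.adjoin_induction with
    | mem g hg =>
      obtain ⟨φ, rfl⟩ := hg
      exact (LinearMap.toContinuousLinearMap φ).analyticOnNhd _
    | algebraMap c => exact analyticOnNhd_const
    | add g h _ _ hg hh => exact hg.add hh
    | mul g h _ _ hg hh => exact hg.mul hh
  let b := Module.finBasis ℝ F
  have : f = fun x => ∑ i, b.coord i (f x) • b i := funext fun x => (b.sum_repr (f x)).symm
  rw [this]
  exact Finset.analyticOnNhd_fun_sum _ fun i _ => (scalar _ (hf (b.coord i))).smul
    analyticOnNhd_const

end IsPolyMap

end PolyMap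

section Thin

variable {K E F G : Type*} [Field K] [AddCommGroup E] [Module K E] [AddCommGroup F] [Module K F]
  [AddCommGroup G] [Module K G]

variable (K) in
/-- A subset of a vector space is thin if some non-zero polynomial function vanishes on it. -/
def Thin (Z : Set E) : Prop :=
  ∃ Q : E → K, IsPolyMap K Q ∧ Q ≠ 0 ∧ ∀ z ∈ Z, Q z = 0

variable (K) in
/-- A subset of a vector space has polynomial dimension at most `d` if it is covered by the images
of finitely many polynomial maps defined on `K ^ d`. -/
def PolyDimLE (d : ℕ) (Z : Set E) : Prop :=
  ∃ (n : ℕ) (f : Fin n → (Fin d → K) → E), (∀ i, IsPolyMap K (f i)) ∧ Z ⊆ ⋃ i, Set.range (f i)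

namespace Thin

variable {Z W : Set E}

theorem mono (hW : Thin K W) (h : Z ⊆ W) : Thin K Z := by
  obtain ⟨Q, hQ, hQ0, hQW⟩ := hW
  exact ⟨Q, hQ, hQ0, fun z hz => hQW z (h hz)⟩

variable (K E) in
theorem empty : Thin K (∅ : Set E) :=
  ⟨fun _ => 1, .const 1, fun h => one_ne_zero (congrFun h 0), fun _ hz => hz.elim⟩

theorem setOf_and {c : Prop} {p : E → Prop} (h : c → Thin K {x | p x}) :
    Thin K {x | c ∧ p x} := by
  by_cases hc : c
  · exact (h hc).mono fun _ hx => hx.2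
  · exact (empty K E).mono fun _ hx => hc hx.1

variable [Infinite K] [FiniteDimensional K E]

theorem union (hZ : Thin K Z) (hW : Thin K W) : Thin K (Z ∪ W) := by
  obtain ⟨Q, hQ, hQ0, hQZ⟩ := hZ
  obtain ⟨R, hR, hR0, hRW⟩ := hW
  refine ⟨fun x => Q x * R x, hQ.mul hR, fun h => ?_, ?_⟩
  · rcases hQ.eq_zero_or_eq_zero_of_mul_eq_zero hR (congrFun h) with h | h
    exacts [hQ0 h, hR0 h]
  · rintro z (hz | hz)
    · simp only [hQZ z hz, zero_mul]
    · simp only [hRW z hz, mul_zero]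

theorem iUnion {ι : Type*} [Finite ι] {Z : ι → Set E} (h : ∀ i, Thin K (Z i)) :
    Thin K (⋃ i, Z i) := by
  classical
  have := Fintype.ofFinite ι
  suffices ∀ s : Finset ι, Thin K (⋃ i ∈ s, Z i) by simpa using this Finset.univ
  intro s
  induction s using Finset.induction_on with
  | empty => simpa using empty K E
  | insert i s _ ih =>
    rw [Finset.set_biUnion_insert]
    exact (h i).union ih

theorem setOf_exists {ι : Type*} [Finite ι] {p : ι → E → Prop} (h : ∀ i, Thin K {x | p i x}) :
    Thin K {x | ∃ i, p i x} :=
  (iUnion h).mono fun _ hx => Set.mem_iUnion.2 hx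

end Thin

/-- Too many polynomials in `d` variables are algebraically dependent. -/
theorem IsPolyMap.thin_range [Infinite K] [FiniteDimensional K E] {d : ℕ}
    {f : (Fin d → K) → E} (hf : IsPolyMap K f) (hd : d < Module.finrank K E) :
    Thin K (Set.range f) := by
  let b := Module.finBasis K E
  have coordinate : ∀ i, ∃ p : MvPolynomial (Fin d) K, ∀ t, b.equivFun (f t) i = p.eval t := by
    intro i
    have : IsPolyMap K fun t => b.coord i (f t) := by fun_prop
    simpa using! this.exists_mvPolynomial (Pi.basisFun K (Fin d))
  choose p hp using coordinate
  have dependent : ¬ AlgebraicIndependent K p := fun hi => by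
    have := hi.lift_cardinalMk_le_trdeg
    simp only [MvPolynomial.trdeg_of_isDomain, Cardinal.mk_fintype, Cardinal.lift_natCast,
      Nat.cast_le, Fintype.card_fin] at this
    omega
  rw [algebraicIndependent_iff] at dependent
  push Not at dependent
  obtain ⟨Q, hQ, hQ0⟩ := dependent
  refine ⟨fun x => Q.eval (b.equivFun x),
    (IsPolyMap.eval Q).comp (.linearMap_apply b.equivFun.toLinearMap), fun h => hQ0 ?_, ?_⟩
  · refine MvPolynomial.funext fun x => ?_
    simpa only [LinearEquiv.apply_symm_apply, map_zero, Pi.zero_apply]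
      using congrFun h (b.equivFun.symm x)
  · rintro _ ⟨t, rfl⟩
    have : b.equivFun (f t) = fun i => (p i).eval t := funext fun i => hp i t
    change Q.eval (b.equivFun (f t)) = 0
    rw [this, ← map_zero (MvPolynomial.eval t), ← hQ, ← MvPolynomial.aeval_eq_eval,
      ← MvPolynomial.aeval_eq_eval, MvPolynomial.comp_aeval_apply]

namespace PolyDimLE

variable {d e : ℕ} {Z W : Set E}

theorem of_iUnion_range {ι P : Type*} [Finite ι] [AddCommGroup P] [Module K P]
    [FiniteDimensional K P] (hd : Module.finrank K P ≤ d) {f : ι → P → E}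
    (hf : ∀ i, IsPolyMap K (f i)) (hZ : Z ⊆ ⋃ i, Set.range (f i)) : PolyDimLE K d Z := by
  let l : (Fin d → K) →ₗ[K] P :=
    (Module.finBasis K P).equivFun.symm.toLinearMap ∘ₗ LinearMap.funLeft K K (Fin.castLE hd)
  have hl : Function.Surjective l := (Module.finBasis K P).equivFun.symm.surjective.comp
    (LinearMap.funLeft_surjective_of_injective K K _ (Fin.castLE_injective hd))
  let e := Finite.equivFin ι
  refine ⟨Nat.card ι, fun i t => f (e.symm i) (l t),
    fun i => (hf _).comp (.linearMap_apply l), fun z hz => ?_⟩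
  obtain ⟨i, p, rfl⟩ := Set.mem_iUnion.1 (hZ hz)
  obtain ⟨t, rfl⟩ := hl p
  exact Set.mem_iUnion.2 ⟨e i, t, by simp⟩

theorem mono (hW : PolyDimLE K d W) (h : Z ⊆ W) : PolyDimLE K d Z := by
  obtain ⟨n, f, hf, hW⟩ := hW
  exact ⟨n, f, hf, h.trans hW⟩

theorem of_isPolyMap {P : Type*} [AddCommGroup P] [Module K P] [FiniteDimensional K P]
    (hd : Module.finrank K P ≤ d) {f : P → E} (hf : IsPolyMap K f) (hZ : Z ⊆ Set.range f) :
    PolyDimLE K d Z :=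
  of_iUnion_range (ι := Unit) hd (fun _ => hf) (by rwa [Set.iUnion_const])

theorem univ [FiniteDimensional K E] (hd : Module.finrank K E ≤ d) :
    PolyDimLE K d (Set.univ : Set E) :=
  of_isPolyMap hd .id (by simp)

theorem le (hZ : PolyDimLE K d Z) (h : d ≤ e) : PolyDimLE K e Z := by
  obtain ⟨n, f, hf, hZ⟩ := hZ
  exact of_iUnion_range (by simpa using h) hf hZ

theorem iUnion {ι : Type*} [Finite ι] {Z : ι → Set E} (h : ∀ i, PolyDimLE K d (Z i)) :
    PolyDimLE K d (⋃ i, Z i) := by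
  choose n f hf hZ using h
  refine of_iUnion_range (ι := Σ i, Fin (n i)) (P := Fin d → K) (by simp) (fun q => hf q.1 q.2) ?_
  rw [Set.iUnion_sigma]
  exact Set.iUnion_mono hZ

theorem union (hZ : PolyDimLE K d Z) (hW : PolyDimLE K d W) : PolyDimLE K d (Z ∪ W) := by
  rw [Set.union_eq_iUnion]
  exact .iUnion (Bool.rec hW hZ)

theorem image {Φ : E → F} (hΦ : IsPolyMap K Φ) (hZ : PolyDimLE K d Z) :
    PolyDimLE K d (Φ '' Z) := by
  obtain ⟨n, f, hf, hZ⟩ := hZ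
  refine of_iUnion_range (P := Fin d → K) (by simp) (fun i => hΦ.comp (hf i)) ?_
  rw [Set.image_subset_iff]
  intro z hz
  obtain ⟨i, t, rfl⟩ := Set.mem_iUnion.1 (hZ hz)
  exact Set.mem_iUnion.2 ⟨i, t, rfl⟩

theorem prod {W : Set F} (hZ : PolyDimLE K d Z) (hW : PolyDimLE K e W) :
    PolyDimLE K (d + e) (Z ×ˢ W) := by
  obtain ⟨n, f, hf, hZ⟩ := hZ
  obtain ⟨m, g, hg, hW⟩ := hW
  refine of_iUnion_range (ι := Fin n × Fin m) (P := (Fin d → K) × (Fin e → K))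
    (f := fun q t => (f q.1 t.1, g q.2 t.2)) (by simp)
    (fun q => ((hf q.1).comp (.fst .id)).prodMk ((hg q.2).comp (.snd .id))) ?_
  rintro ⟨z, w⟩ ⟨hz, hw⟩
  obtain ⟨i, t, rfl⟩ := Set.mem_iUnion.1 (hZ hz)
  obtain ⟨j, r, rfl⟩ := Set.mem_iUnion.1 (hW hw)
  exact Set.mem_iUnion.2 ⟨(i, j), (t, r), rfl⟩

theorem pi {ι : Type*} [Fintype ι] {M : ι → Type*} [∀ i, AddCommGroup (M i)]
    [∀ i, Module K (M i)] {d : ι → ℕ} {Z : ∀ i, Set (M i)} (h : ∀ i, PolyDimLE K (d i) (Z i)) :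
    PolyDimLE K (∑ i, d i) (Set.pi Set.univ Z) := by
  choose n f hf hZ using h
  refine of_iUnion_range (ι := ∀ i, Fin (n i)) (P := ∀ i, Fin (d i) → K)
    (f := fun c t i => f i (c i) (t i)) (by simp [Module.finrank_pi_fintype])
    (fun c => .pi fun i => (hf i (c i)).comp (.apply i)) fun z hz => ?_
  have hz' : ∀ i, ∃ c t, f i c t = z i := fun i => Set.mem_iUnion.1 (hZ i (hz i trivial))
  choose c t hct using hz'
  exact Set.mem_iUnion.2 ⟨c, t, funext hct⟩

theorem thin [Infinite K] [FiniteDimensional K E] (hZ : PolyDimLE K d Z)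
    (hd : d < Module.finrank K E) : Thin K Z := by
  obtain ⟨n, f, hf, hZ⟩ := hZ
  exact (Thin.iUnion fun i => (hf i).thin_range hd).mono hZ

theorem supportedOn {ι : Type*} [Finite ι] [FiniteDimensional K E] (T : Finset ι) :
    PolyDimLE K (T.card * Module.finrank K E) {f : ι → E | ∀ l ∉ T, f l = 0} := by
  classical
  have := Fintype.ofFinite ι
  have factor : ∀ l, PolyDimLE K (if l ∈ T then Module.finrank K E else 0)
      {v : E | l ∉ T → v = 0} := by
    intro l
    by_cases hl : l ∈ T
    · simpa [hl] using univ le_rfl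
    · simpa [hl] using of_isPolyMap (P := Fin 0 → K) (E := E) (by simp) (.const 0)
        Set.range_const.ge
  refine ((pi factor).le (by simp)).mono fun f hf l _ => hf l

end PolyDimLE

end Thin

section RealPolynomials

theorem IsPolyMap.eq_zero_of_eventuallyEq {E : Type*} [NormedAddCommGroup E] [NormedSpace ℝ E]
    [FiniteDimensional ℝ E] {Q : E → ℝ} (hQ : IsPolyMap ℝ Q) {x : E}
    (h : Q =ᶠ[nhds x] 0) : Q = 0 :=
  hQ.analyticOnNhd.eq_of_eventuallyEq (fun _ _ => analyticAt_const) h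

/-- The map `(v, a) ↦ (v, G (v, a))` is dominant, because it is open near a point at which the
derivative of `G` with respect to `a` is surjective. -/
theorem IsPolyMap.exists_graph_ne_zero {E A H : Type*}
    [NormedAddCommGroup E] [NormedSpace ℝ E] [FiniteDimensional ℝ E]
    [NormedAddCommGroup A] [NormedSpace ℝ A] [FiniteDimensional ℝ A]
    [NormedAddCommGroup H] [NormedSpace ℝ H] [FiniteDimensional ℝ H]
    {G : E × A → H} (hG : IsPolyMap ℝ G) {v₀ : E} {a₀ : A} {G' : A →L[ℝ] H}
    (hG' : HasFDerivAt (fun a => G (v₀, a)) G' a₀) (hsurj : Function.Surjective G')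
    {Q : E × H → ℝ} (hQ : IsPolyMap ℝ Q) (hQ0 : Q ≠ 0) : ∃ v a, Q (v, G (v, a)) ≠ 0 := by
  by_contra! hzero
  let graph : E × A → E × H := fun p => (p.1, G p)
  have total := ((hG.analyticOnNhd (v₀, a₀) trivial).hasStrictFDerivAt)
  have hpartial : fderiv ℝ G (v₀, a₀) ∘L ContinuousLinearMap.inr ℝ E A = G' :=
    (total.hasFDerivAt.comp a₀ (hasFDerivAt_prodMk_right v₀ a₀)).unique hG'
  have hgraph : HasStrictFDerivAt graph
      ((ContinuousLinearMap.fst ℝ E A).prod (fderiv ℝ G (v₀, a₀))) (v₀, a₀) :=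
    hasStrictFDerivAt_fst.prodMk total
  have hrange : ((ContinuousLinearMap.fst ℝ E A).prod (fderiv ℝ G (v₀, a₀))).range = ⊤ := by
    refine LinearMap.range_eq_top.2 fun ⟨v, h⟩ => ?_
    obtain ⟨a, ha⟩ := hsurj (h - fderiv ℝ G (v₀, a₀) (v, 0))
    refine ⟨(v, a), Prod.ext rfl ?_⟩
    have : fderiv ℝ G (v₀, a₀) (0, a) = G' a := by rw [← hpartial]; rfl
    change fderiv ℝ G (v₀, a₀) (v, a) = h
    rw [← Prod.fst_add_snd (v, a), map_add, this, ha, add_sub_cancel]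
  refine hQ0 (hQ.eq_zero_of_eventuallyEq (x := graph (v₀, a₀)) ?_)
  rw [Filter.EventuallyEq, ← hgraph.map_nhds_eq_of_surj hrange, Filter.eventually_map]
  exact Filter.Eventually.of_forall fun p => hzero p.1 p.2

theorem isRealAlgebraic_setOf_eq_zero {σ : Type*} [Finite σ] {f : (σ → ℝ) → ℝ}
    (hf : IsPolyMap ℝ f) : IsRealAlgebraic {z | f z = 0} := by
  obtain ⟨p, hp⟩ := hf.exists_mvPolynomial (Pi.basisFun ℝ σ)
  refine ⟨Ideal.span {p}, ?_⟩
  ext z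
  simp [MvPolynomial.zeroLocus_span, hp, MvPolynomial.aeval_eq_eval]

theorem forGenericBasis_of_thin {N : ℕ} {p : (Fin N → Fin N → ℝ) → Prop}
    (h : Thin ℝ {V | LinearIndependent ℝ V ∧ ¬ p V}) : ForGenericBasis N p := by
  obtain ⟨Q, hQ, hQ0, hQZ⟩ := h
  have hcurry : IsPolyMap ℝ (Function.curry : (Fin N × Fin N → ℝ) → Fin N → Fin N → ℝ) :=
    .linearMap_apply (LinearEquiv.curry ℝ ℝ (Fin N) (Fin N)).toLinearMap
  refine ⟨_, isRealAlgebraic_setOf_eq_zero (hQ.comp hcurry), ?_, ?_⟩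
  · obtain ⟨V, hV⟩ : ∃ V : Fin N → Fin N → ℝ, Q V * (Matrix.of V).det ≠ 0 := by
      by_contra! hzero
      rcases hQ.eq_zero_or_eq_zero_of_mul_eq_zero .det hzero with h | h
      · exact hQ0 h
      · exact one_ne_zero (Matrix.det_one.symm.trans (congrFun h (1 : Matrix (Fin N) (Fin N) ℝ)))
    have hli : LinearIndependent ℝ V :=
      Matrix.linearIndependent_rows_of_det_ne_zero (right_ne_zero_of_mul hV)
    exact ⟨Function.uncurry V, ⟨hli, hli.span_eq_top_of_card_eq_finrank' (by simp)⟩,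
      left_ne_zero_of_mul hV⟩
  · rintro A ⟨hA, hAQ⟩
    by_contra hp
    exact hAQ (hQZ _ ⟨hA.1, hp⟩)

end RealPolynomials

section Incidence

variable {K ι E : Type*} [Field K] [AddCommGroup E] [Module K E]

theorem exists_minor_ne_zero {a b : ι → K} (h : LinearIndependent K ![a, b]) :
    ∃ i j, a i ≠ 0 ∧ b j ≠ 0 ∧ a i * b j - a j * b i ≠ 0 := by
  by_contra! H
  have minor : ∀ i j, b i * a j - a i * b j = 0 := by
    intro i j
    by_cases hij : a i = 0 ∨ b j = 0
    · by_cases hji : a j = 0 ∨ b i = 0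
      · rcases hij with hij | hij <;> rcases hji with hji | hji <;> simp [hij, hji]
      · push Not at hji
        linear_combination H j i hji.1 hji.2
    · push Not at hij
      linear_combination -H i j hij.1 hij.2
  obtain ⟨i, hi⟩ := Function.ne_iff.1 (h.ne_zero 0)
  refine hi (neg_eq_zero.1 (LinearIndependent.pair_iff.1 h (b i) (-a i) (funext fun j => ?_)).2)
  simpa [sub_eq_add_neg] using minor i j

theorem span_image_inter {V : ι → E} (hV : LinearIndependent K V) (s t : Set ι) :
    Submodule.span K (V '' (s ∩ t)) = Submodule.span K (V '' s) ⊓ Submodule.span K (V '' t) := by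
  simp only [Finsupp.span_image_eq_map_linearCombination, Finsupp.supported_inter]
  exact Submodule.map_inf _ hV

variable [Fintype ι]

theorem mem_span_image_iff_exists_sum {V : ι → E} {S : Finset ι} {x : E} :
    x ∈ Submodule.span K (V '' S) ↔ ∃ a : ι → K, (∀ l ∉ S, a l = 0) ∧ x = ∑ l, a l • V l := by
  classical
  rw [Submodule.mem_span_image_finset_iff_exists_fun']
  constructor
  · rintro ⟨c, rfl⟩
    exact ⟨fun l => if l ∈ S then c l else 0, fun l hl => if_neg hl, by simp [ite_smul]⟩
  · rintro ⟨a, ha, rfl⟩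
    exact ⟨a, Finset.sum_subset S.subset_univ fun l _ hl => by rw [ha l hl, zero_smul]⟩

theorem polyDimLE_setOf_mem_span [FiniteDimensional K E] (T : Finset ι) :
    PolyDimLE K (Fintype.card ι * Module.finrank K E + T.card)
      {p : (ι → E) × E | p.2 ∈ Submodule.span K (p.1 '' T)} := by
  have param := ((PolyDimLE.univ (K := K) (E := ι → E) le_rfl).prod
    (PolyDimLE.supportedOn (K := K) (E := K) T)).image
    (Φ := fun q => (q.1, ∑ l, q.2 l • q.1 l)) (by fun_prop)
  rw [Module.finrank_pi_fintype, Finset.sum_const, Finset.card_univ, smul_eq_mul,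
    Module.finrank_self, mul_one] at param
  refine param.mono ?_
  rintro ⟨V, x⟩ hx
  obtain ⟨a, ha, hax⟩ := mem_span_image_iff_exists_sum.1 hx
  exact ⟨(V, a), ⟨trivial, ha⟩, Prod.ext rfl hax.symm⟩

variable (K) in
/-- The pairs `(V, u)` of a family of vectors and a vector `u` in the span of the `V l`, `l ∈ S₁`,
such that some `w` in the span of the `V l`, `l ∈ S₂`, is independent of `u` and related to `u` by
`Q`. -/
def incidence (S₁ S₂ : Finset ι) (Q : Set (E × E)) : Set ((ι → E) × E) :=
  {p | p.2 ∈ Submodule.span K (p.1 '' S₁) ∧ ∃ w ∈ Submodule.span K (p.1 '' S₂),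
    (p.2, w) ∈ Q ∧ LinearIndependent K ![p.2, w]}

variable (K) in
/-- The pairs `(V, ∑ l, a l • V l)` for which `(∑ l, a l • V l, ∑ l, b l • V l)` satisfies `Q`, with
`a` supported on `S₁` and `b` on `S₂`, normalised so that `a i = 1` and the minor of `a, b` at the
indices `i, j` is `1`. -/
def normalizedIncidence (S₁ S₂ : Finset ι) (Q : Set (E × E)) (i j : ι) : Set ((ι → E) × E) :=
  {p | ∃ a b : ι → K, (∀ l ∉ S₁, a l = 0) ∧ (∀ l ∉ S₂, b l = 0) ∧ a i = 1 ∧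
    b j = 1 + a j * b i ∧ p.2 = ∑ l, a l • p.1 l ∧ (p.2, ∑ l, b l • p.1 l) ∈ Q}

variable {S₁ S₂ : Finset ι} {Q : Set (E × E)} {d D : ℕ}

theorem exists_normalizedIncidence
    (hQ : ∀ c e : K, c ≠ 0 → e ≠ 0 → ∀ q ∈ Q, (c • q.1, e • q.2) ∈ Q) {p : (ι → E) × E}
    (hp : p ∈ incidence K S₁ S₂ Q) :
    ∃ i ∈ S₁, ∃ j ∈ S₂, i ≠ j ∧ ∃ c : K, (p.1, c • p.2) ∈ normalizedIncidence K S₁ S₂ Q i j ∧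
      c ≠ 0 := by
  obtain ⟨V, u⟩ := p
  obtain ⟨hu, w, hw, huw, hli⟩ := hp
  obtain ⟨a, ha, hau⟩ := mem_span_image_iff_exists_sum.1 hu
  obtain ⟨b, hb, rfl⟩ := mem_span_image_iff_exists_sum.1 hw
  obtain rfl : u = ∑ l, a l • V l := hau
  have hab : LinearIndependent K ![a, b] := by
    refine LinearIndependent.of_comp (Fintype.linearCombination K V) ?_
    convert hli using 1
    funext k
    fin_cases k <;> simp [Fintype.linearCombination_apply]
  obtain ⟨i, j, hi, hj, hm⟩ := exists_minor_ne_zero hab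
  refine ⟨i, by_contra fun h => hi (ha i h), j, by_contra fun h => hj (hb j h), ?_, (a i)⁻¹,
    ⟨(a i)⁻¹ • a, (a i / (a i * b j - a j * b i)) • b, ?_, ?_, ?_, ?_, ?_, ?_⟩, inv_ne_zero hi⟩
  · rintro rfl
    exact hm (by ring)
  · exact fun l hl => by simp [ha l hl]
  · exact fun l hl => by simp [hb l hl]
  · simp [hi]
  · simp only [Pi.smul_apply, smul_eq_mul]
    field_simp
    ring
  · simp [Finset.smul_sum, mul_smul]
  · simpa [Finset.smul_sum, mul_smul] using
      hQ (a i)⁻¹ (a i / (a i * b j - a j * b i)) (inv_ne_zero hi) (div_ne_zero hi hm) _ huw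

section Reconstruction

variable [DecidableEq ι]

/-- The `j`-th vector of a family `V`, recovered from `(a, b, W, u, w)`: the families `a`, `b`, `W`
are `0` at `i`, at `j`, and at both respectively, `W` agrees with `V` elsewhere, and
`u = V i + ∑ l, a l • V l`, `w = (1 + a j * b i) • V j + ∑ l, b l • V l`. -/
def recoverSnd (i : ι) (p : (ι → K) × (ι → K) × (ι → E) × E × E) : E :=
  p.2.2.2.2 - p.2.1 i • p.2.2.2.1 - ∑ l, (p.2.1 l - p.2.1 i * p.1 l) • p.2.2.1 l

/-- The `i`-th vector of the family of which `recoverSnd` is the `j`-th vector. -/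
def recoverFst (i j : ι) (p : (ι → K) × (ι → K) × (ι → E) × E × E) : E :=
  p.2.2.2.1 - p.1 j • recoverSnd i p - ∑ l, p.1 l • p.2.2.1 l

/-- The family whose `i`-th and `j`-th vectors are `recoverFst` and `recoverSnd`. -/
def recover (i j : ι) (p : (ι → K) × (ι → K) × (ι → E) × E × E) : ι → E :=
  p.2.2.1 + Pi.single i (recoverFst i j p) + Pi.single j (recoverSnd i p)

theorem isPolyMap_recover (i j : ι) : IsPolyMap K (recover (K := K) (E := E) i j) := by
  have hsnd : IsPolyMap K (recoverSnd (K := K) (E := E) i) := by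
    unfold recoverSnd
    fun_prop
  have hfst : IsPolyMap K (recoverFst (K := K) (E := E) i j) := by
    unfold recoverFst
    fun_prop
  have hsingle (k : ι) : IsPolyMap K fun v : E => (Pi.single k v : ι → E) :=
    .linearMap_apply (LinearMap.single K (fun _ => E) k)
  have := ((hsingle i).comp hfst).add ((hsingle j).comp hsnd)
  unfold recover
  fun_prop

theorem sum_smul_eq_add_add_sum (V : ι → E) {i j : ι} (hij : i ≠ j) {c c' : ι → K}
    (hc : ∀ l, l ≠ i → l ≠ j → c' l = c l) :
    ∑ l, c l • V l = c i • V i + c j • V j +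
      ∑ l, c' l • Function.update (Function.update V i 0) j 0 l := by
  have split : ∀ l, c l • V l = ((if l = i then c i • V i else 0) +
      if l = j then c j • V j else 0) +
      c' l • Function.update (Function.update V i 0) j 0 l := by
    intro l
    by_cases hlj : l = j
    · subst hlj
      simp [hij.symm]
    · by_cases hli : l = i
      · subst hli
        simp [hij]
      · simp [hli, hlj, hc]
  rw [Finset.sum_congr rfl fun l _ => split l]
  simp only [Finset.sum_add_distrib, Finset.sum_ite_eq', Finset.mem_univ, if_true]

theorem recover_eq {i j : ι} (hij : i ≠ j) {V : ι → E} {a b : ι → K} (ha : a i = 1)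
    (hb : b j = 1 + a j * b i) :
    recover i j (Function.update a i 0, Function.update b j 0,
      Function.update (Function.update V i 0) j 0, ∑ l, a l • V l, ∑ l, b l • V l) = V := by
  set W := Function.update (Function.update V i 0) j 0 with hW
  have hu := sum_smul_eq_add_add_sum V hij fun l (hli : l ≠ i) (_ : l ≠ j) =>
    Function.update_of_ne hli 0 a
  have hw := sum_smul_eq_add_add_sum V hij fun l (_ : l ≠ i) (hlj : l ≠ j) =>
    Function.update_of_ne hlj 0 b
  rw [← hW] at hu hw
  have hVj : recoverSnd i (Function.update a i 0, Function.update b j 0, W,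
      ∑ l, a l • V l, ∑ l, b l • V l) = V j := by
    simp only [recoverSnd, Function.update_of_ne hij, sub_smul, mul_smul, Finset.sum_sub_distrib,
      ← Finset.smul_sum, hu, hw, ha, hb]
    module
  have hVi : recoverFst i j (Function.update a i 0, Function.update b j 0, W,
      ∑ l, a l • V l, ∑ l, b l • V l) = V i := by
    rw [recoverFst, hVj]
    simp only [Function.update_of_ne hij.symm, hu, ha]
    module
  rw [recover, hVi, hVj]
  funext l
  by_cases hlj : l = j
  · subst hlj
    simp [hW, hij.symm]
  · by_cases hli : l = i
    · subst hli
      simp [hW, hij]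
    · simp [hW, hli, hlj]

end Reconstruction

/-- Solving for the `i`-th and the `j`-th vector of `V` saves `2 * finrank K E` parameters, and the
normalisation saves two. -/
theorem polyDimLE_normalizedIncidence [FiniteDimensional K E] (hQ : PolyDimLE K d Q) {i j : ι}
    (hi : i ∈ S₁) (hj : j ∈ S₂) (hij : i ≠ j)
    (hD : d + S₁.card + S₂.card + Fintype.card ι * Module.finrank K E
      ≤ D + 2 * Module.finrank K E + 2) :
    PolyDimLE K D (normalizedIncidence K S₁ S₂ Q i j) := by
  classical
  have hcard : (S₁.erase i).card + ((S₂.erase j).card +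
      (({i, j} : Finset ι)ᶜ.card * Module.finrank K E + d)) ≤ D := by
    have := ({i, j} : Finset ι).card_compl_add_card
    rw [Finset.card_pair hij] at this
    rw [← this, add_mul] at hD
    have := Finset.card_erase_add_one hi
    have := Finset.card_erase_add_one hj
    omega
  have hΦ : IsPolyMap K fun p : (ι → K) × (ι → K) × (ι → E) × E × E =>
      (recover i j p, p.2.2.2.1) := (isPolyMap_recover i j).prodMk (by fun_prop)
  refine ((((PolyDimLE.supportedOn (S₁.erase i)).prod ((PolyDimLE.supportedOn (S₂.erase j)).prod
    ((PolyDimLE.supportedOn ({i, j} : Finset ι)ᶜ).prod hQ))).image hΦ).le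
    (by simpa using hcard)).mono ?_
  rintro ⟨V, u⟩ ⟨a, b, ha, hb, hai, hbj, hu, huw⟩
  refine ⟨(Function.update a i 0, Function.update b j 0,
      Function.update (Function.update V i 0) j 0, u, ∑ l, b l • V l), ⟨?_, ?_, ?_, huw⟩, ?_⟩
  · grind [Function.update_apply]
  · grind [Function.update_apply]
  · intro l hl
    rw [Finset.mem_compl, not_not, Finset.mem_insert, Finset.mem_singleton] at hl
    grind [Function.update_apply]
  · obtain rfl : u = ∑ l, a l • V l := hu
    exact Prod.ext (recover_eq hij hai hbj) rfl

theorem polyDimLE_fst_image_incidence [FiniteDimensional K E] (hQd : PolyDimLE K d Q)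
    (hQ : ∀ c e : K, c ≠ 0 → e ≠ 0 → ∀ q ∈ Q, (c • q.1, e • q.2) ∈ Q)
    (hD : d + S₁.card + S₂.card + Fintype.card ι * Module.finrank K E
      ≤ D + 2 * Module.finrank K E + 2) :
    PolyDimLE K D (Prod.fst '' incidence K S₁ S₂ Q) := by
  classical
  refine (PolyDimLE.iUnion (ι := {q : ι × ι // q.1 ∈ S₁ ∧ q.2 ∈ S₂ ∧ q.1 ≠ q.2}) fun q =>
    (polyDimLE_normalizedIncidence hQd q.2.1 q.2.2.1 q.2.2.2 hD).image (.fst .id)).mono ?_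
  rintro _ ⟨p, hp, rfl⟩
  obtain ⟨i, hi, j, hj, hij, c, hc, -⟩ := exists_normalizedIncidence hQ hp
  exact Set.mem_iUnion.2 ⟨⟨(i, j), hi, hj, hij⟩, _, hc, rfl⟩

/-- In contrast to `polyDimLE_fst_image_incidence`, the scale of `u` costs one parameter. -/
theorem polyDimLE_incidence [FiniteDimensional K E] (hQd : PolyDimLE K d Q)
    (hQ : ∀ c e : K, c ≠ 0 → e ≠ 0 → ∀ q ∈ Q, (c • q.1, e • q.2) ∈ Q)
    (hD : d + S₁.card + S₂.card + Fintype.card ι * Module.finrank K E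
      ≤ D + 2 * Module.finrank K E + 1) :
    PolyDimLE K D (incidence K S₁ S₂ Q) := by
  classical
  have scaled : ∀ q : {q : ι × ι // q.1 ∈ S₁ ∧ q.2 ∈ S₂ ∧ q.1 ≠ q.2}, PolyDimLE K D
      ((fun r : K × (ι → E) × E => (r.2.1, r.1 • r.2.2)) ''
        Set.univ ×ˢ normalizedIncidence K S₁ S₂ Q q.1.1 q.1.2) := by
    rintro ⟨⟨i, j⟩, hi, hj, hij⟩
    have := Nat.mul_le_mul_right (Module.finrank K E)
      ((Finset.card_pair hij).symm.trans_le (Finset.card_le_univ _))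
    have := Finset.card_pos.2 ⟨i, hi⟩
    have := Finset.card_pos.2 ⟨j, hj⟩
    exact (((PolyDimLE.univ (Module.finrank_self K).le).prod
      (polyDimLE_normalizedIncidence (D := D - 1) hQd hi hj hij (by omega))).image
        (by fun_prop)).le (by omega)
  refine (PolyDimLE.iUnion scaled).mono ?_
  rintro ⟨V, u⟩ hp
  obtain ⟨i, hi, j, hj, hij, c, hcp, hc⟩ := exists_normalizedIncidence hQ hp
  exact Set.mem_iUnion.2 ⟨⟨(i, j), hi, hj, hij⟩, (c⁻¹, _), ⟨trivial, hcp⟩, by simp [hc]⟩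

end Incidence

section Fourier

variable {N : ℕ}

/-- The discrete Fourier transform of real vectors, as a real linear map. -/
noncomputable def dft (N : ℕ) : (Fin N → ℝ) →ₗ[ℝ] (Fin N → ℂ) :=
  (dftMatrix N).mulVecLin.restrictScalars ℝ ∘ₗ Complex.ofRealCLM.toLinearMap.compLeft (Fin N)

theorem dft_apply (x : Fin N → ℝ) : dft N x = (dftMatrix N).mulVec fun n => (x n : ℂ) := rfl

theorem powerSpectrum_apply (x : Fin N → ℝ) (k : Fin N) :
    powerSpectrum x k = ‖dft N x k‖ ^ 2 := rfl

theorem powerSpectrum_eq_iff {x y : Fin N → ℝ} :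
    powerSpectrum x = powerSpectrum y ↔ ∀ k, ‖dft N x k‖ = ‖dft N y k‖ := by
  simp only [funext_iff, powerSpectrum_apply,
    pow_left_inj₀ (norm_nonneg _) (norm_nonneg _) two_ne_zero]

theorem isPolyMap_powerSpectrum : IsPolyMap ℝ (powerSpectrum : (Fin N → ℝ) → Fin N → ℝ) := by
  have coeff (l : ℂ →ₗ[ℝ] ℝ) (k : Fin N) : IsPolyMap ℝ fun x => l (dft N x k) :=
    .linearMap_apply (l ∘ₗ LinearMap.proj k ∘ₗ dft N)
  refine .pi fun k => ?_
  simp only [powerSpectrum_apply, Complex.sq_norm, Complex.normSq_apply]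
  exact ((coeff Complex.reCLM k).mul (coeff Complex.reCLM k)).add
    ((coeff Complex.imCLM k).mul (coeff Complex.imCLM k))

theorem isUnit_dftMatrix (N : ℕ) [NeZero N] : IsUnit (dftMatrix N) := by
  have vandermonde : dftMatrix N = Matrix.vandermonde fun k : Fin N =>
      Complex.exp (2 * Real.pi * Complex.I / N) ^ (k : ℕ) := by
    ext k n
    simp [dftMatrix, Matrix.vandermonde_apply, pow_mul]
  rw [Matrix.isUnit_iff_isUnit_det, isUnit_iff_ne_zero, vandermonde,
    Matrix.det_vandermonde_ne_zero_iff]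
  exact fun k l hkl =>
    Fin.ext ((Complex.isPrimitiveRoot_exp N (NeZero.ne N)).pow_inj k.2 l.2 hkl)

theorem dft_injective (N : ℕ) [NeZero N] : Function.Injective (dft N) := fun _ _ h =>
  funext fun n => Complex.ofReal_injective
    (congrFun (Matrix.mulVec_injective_iff_isUnit.2 (isUnit_dftMatrix N) h) n)

theorem dftMatrix_neg [NeZero N] (k n : Fin N) :
    dftMatrix N (-k) n = (starRingEnd ℂ) (dftMatrix N k n) := by
  have hω := Complex.isPrimitiveRoot_exp N (NeZero.ne N)
  simp only [dftMatrix, Matrix.of_apply]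
  set ω := Complex.exp (2 * Real.pi * Complex.I / N)
  have hmul : ω ^ (((-k : Fin N) : ℕ) * n) * ω ^ ((k : ℕ) * n) = 1 := by
    rw [← pow_add, ← add_mul, hω.pow_eq_one_iff_dvd]
    refine Dvd.dvd.mul_right ?_ _
    rw [Fin.val_neg]
    split_ifs with hk
    · simp [hk]
    · rw [Nat.sub_add_cancel k.2.le]
  have hnorm : ‖ω‖ = 1 := Complex.norm_eq_one_of_pow_eq_one hω.pow_eq_one (NeZero.ne N)
  rw [eq_inv_of_mul_eq_one_left hmul, Complex.inv_eq_conj (by rw [norm_pow, hnorm, one_pow])]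

theorem dftMatrix_mulVec_conj_neg [NeZero N] (c : Fin N → ℂ) (k : Fin N) :
    (dftMatrix N).mulVec (fun n => (starRingEnd ℂ) (c n)) (-k) =
      (starRingEnd ℂ) ((dftMatrix N).mulVec c k) := by
  simp [Matrix.mulVec, dotProduct, dftMatrix_neg]

theorem dft_neg [NeZero N] (x : Fin N → ℝ) (k : Fin N) :
    dft N x (-k) = (starRingEnd ℂ) (dft N x k) := by
  simpa [dft_apply] using dftMatrix_mulVec_conj_neg (fun n => (x n : ℂ)) k

theorem exists_dft_eq [NeZero N] {z : Fin N → ℂ} (hz : ∀ k, z (-k) = (starRingEnd ℂ) (z k)) :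
    ∃ x, dft N x = z := by
  obtain ⟨c, rfl⟩ := Matrix.mulVec_surjective_iff_isUnit.2 (isUnit_dftMatrix N) z
  have conj_invariant : (fun n => (starRingEnd ℂ) (c n)) = c := by
    refine Matrix.mulVec_injective_iff_isUnit.2 (isUnit_dftMatrix N) (funext fun k => ?_)
    rw [← neg_neg k, dftMatrix_mulVec_conj_neg, ← hz]
  refine ⟨fun n => (c n).re, ?_⟩
  rw [dft_apply]
  congr 1
  exact funext fun n => Complex.conj_eq_iff_re.1 (congrFun conj_invariant n)

theorem EqUpToSign.powerSpectrum_eq {x y : Fin N → ℝ} (h : EqUpToSign x y) :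
    powerSpectrum x = powerSpectrum y := by
  obtain ⟨t, ht, rfl⟩ := h
  exact powerSpectrum_eq_iff.2 fun k => by rw [map_smul, Pi.smul_apply, norm_smul, ht, one_mul]

theorem eqUpToSign_or_linearIndependent [NeZero N] {x y : Fin N → ℝ}
    (h : powerSpectrum x = powerSpectrum y) :
    EqUpToSign x y ∨ LinearIndependent ℝ ![x, y] := by
  refine or_iff_not_imp_right.2 fun hli => ?_
  rw [powerSpectrum_eq_iff] at h
  obtain ⟨s, t, hst, hne⟩ : ∃ s t : ℝ, s • x + t • y = 0 ∧ ¬(s = 0 ∧ t = 0) := by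
    simpa [LinearIndependent.pair_iff] using hli
  by_cases hx : ∃ k, dft N x k ≠ 0
  · obtain ⟨k, hk⟩ := hx
    have hnorm : ‖s‖ * ‖dft N x k‖ = ‖t‖ * ‖dft N x k‖ := by
      have := congrFun (congrArg (dft N) (eq_neg_of_add_eq_zero_left hst)) k
      simp only [map_smul, map_neg, Pi.smul_apply, Pi.neg_apply] at this
      rw [← norm_smul, this, norm_neg, norm_smul, h k]
    have habs : ‖s‖ = ‖t‖ := mul_right_cancel₀ (norm_ne_zero_iff.2 hk) hnorm
    have hs : s ≠ 0 := fun hs => hne ⟨hs, norm_eq_zero.1 (by rw [← habs, hs, norm_zero])⟩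
    refine ⟨-(s⁻¹ * t), ?_, ?_⟩
    · rw [norm_neg, norm_mul, norm_inv, ← habs, inv_mul_cancel₀ (norm_ne_zero_iff.2 hs)]
    · rw [neg_smul, mul_smul, ← smul_neg, ← eq_neg_of_add_eq_zero_left hst, inv_smul_smul₀ hs]
  · push Not at hx
    have hx0 : x = 0 := dft_injective N (funext fun k => by rw [hx, map_zero, Pi.zero_apply])
    have hy0 : y = 0 := dft_injective N (funext fun k => by
      rw [map_zero, Pi.zero_apply, ← norm_eq_zero, ← h, hx, norm_zero])
    exact ⟨1, norm_one, by rw [hx0, hy0, smul_zero]⟩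

/-- The pairs of vectors whose Fourier coefficients are orthogonal, as vectors of the plane, at each
frequency: the pairs `(x + y, x - y)`, where `x` and `y` have the same power spectrum. -/
def orthogonalSpectra (N : ℕ) : Set ((Fin N → ℝ) × (Fin N → ℝ)) :=
  {p | ∀ k, inner ℝ (dft N p.1 k) (dft N p.2 k) = 0}

theorem add_sub_mem_orthogonalSpectra_iff {x y : Fin N → ℝ} :
    (x + y, x - y) ∈ orthogonalSpectra N ↔ powerSpectrum x = powerSpectrum y := by
  simp only [orthogonalSpectra, Set.mem_ofPred_eq, map_add, map_sub, Pi.add_apply, Pi.sub_apply,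
    real_inner_add_sub_eq_zero_iff, powerSpectrum_eq_iff]

theorem smul_mem_orthogonalSpectra (c e : ℝ) {q : (Fin N → ℝ) × (Fin N → ℝ)}
    (hq : q ∈ orthogonalSpectra N) : (c • q.1, e • q.2) ∈ orthogonalSpectra N := fun k => by
  simp only [map_smul, Pi.smul_apply, real_inner_smul_left, real_inner_smul_right, hq k, mul_zero]

/-- The pairs `(x, e • y)`, where `x` and `y` have the same power spectrum. The scalar `e` is there
for stability under scaling both components independently. -/
def scaledCollisions (N : ℕ) : Set ((Fin N → ℝ) × (Fin N → ℝ)) :=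
  {p | ∃ (e : ℝ) (y : Fin N → ℝ), powerSpectrum p.1 = powerSpectrum y ∧ p.2 = e • y}

theorem smul_mem_scaledCollisions {c : ℝ} (hc : c ≠ 0) (e : ℝ)
    {q : (Fin N → ℝ) × (Fin N → ℝ)} (hq : q ∈ scaledCollisions N) :
    (c • q.1, e • q.2) ∈ scaledCollisions N := by
  obtain ⟨x, _⟩ := q
  obtain ⟨e', y, hxy, rfl⟩ := hq
  rw [powerSpectrum_eq_iff] at hxy
  refine ⟨e * e' / c, c • y, powerSpectrum_eq_iff.2 fun k => ?_, ?_⟩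
  · simp only [map_smul, Pi.smul_apply, norm_smul, hxy k]
  · rw [smul_smul, smul_smul, div_mul_cancel₀ _ hc]

theorem polyDimLE_setOf_inner_eq_zero :
    PolyDimLE ℝ 3 {p : ℂ × ℂ | inner ℝ p.1 p.2 = 0} := by
  have charts : ∀ b : Bool, IsPolyMap ℝ fun q : ℝ × ℂ =>
      if b then (q.2, q.1 • (Complex.I * q.2)) else (0, q.2) := by
    have rotate : IsPolyMap ℝ fun z : ℂ => Complex.I * z :=
      .linearMap_apply (LinearMap.mulLeft ℝ Complex.I)
    have hrotate := rotate.comp (.snd (.id : IsPolyMap ℝ fun q : ℝ × ℂ => q))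
    rintro (_ | _)
    · simp only [Bool.false_eq_true, if_false]
      fun_prop
    · simp only [if_true]
      fun_prop
  refine .of_iUnion_range (by simp [Complex.finrank_real_complex]) charts ?_
  rintro ⟨z, w⟩ (hzw : inner ℝ z w = 0)
  rw [Set.mem_iUnion]
  by_cases hz : z = 0
  · exact ⟨false, (0, w), by simp [hz]⟩
  · have quotient : (w / z).re = 0 := by
      have : (w * (starRingEnd ℂ) z).re = 0 := by simpa [Complex.inner] using hzw
      rw [Complex.div_re, ← add_div, div_eq_zero_iff]
      exact .inl (by simpa using this)
    refine ⟨true, ((w / z).im, z), Prod.ext rfl ?_⟩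
    calc (w / z).im • (Complex.I * z) = ((w / z).re + (w / z).im * Complex.I) * z := by
          simp [quotient, mul_assoc]
      _ = w := by rw [Complex.re_add_im, div_mul_cancel₀ w hz]

theorem polyDimLE_setOf_real_inner_eq_zero :
    PolyDimLE ℝ 1 {p : ℂ × ℂ | inner ℝ p.1 p.2 = 0 ∧ p.1.im = 0 ∧ p.2.im = 0} := by
  have charts : ∀ b : Bool, IsPolyMap ℝ fun t : ℝ =>
      if b then ((t : ℂ), (0 : ℂ)) else (0, (t : ℂ)) := by
    have hcast : IsPolyMap ℝ fun t : ℝ => (t : ℂ) := .linearMap_apply Complex.ofRealCLM.toLinearMap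
    rintro (_ | _)
    · simp only [Bool.false_eq_true, if_false]
      fun_prop
    · simp only [if_true]
      fun_prop
  refine .of_iUnion_range (by simp) charts ?_
  rintro ⟨z, w⟩ ⟨hzw, hz, hw⟩
  lift z to ℝ using hz
  lift w to ℝ using hw
  have : z = 0 ∨ w = 0 := by simpa [Complex.inner, or_comm] using hzw
  rw [Set.mem_iUnion]
  rcases this with rfl | rfl
  · exact ⟨false, w, by simp⟩
  · exact ⟨true, z, by simp⟩

section HalfSpectrum

variable [NeZero N]

/-- The frequencies `0, …, ⌊N / 2⌋`, one out of each pair of conjugate frequencies `k, -k`. -/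
def halfFreq (N : ℕ) [NeZero N] : Fin (N / 2 + 1) → Fin N :=
  Fin.castLE (by have := NeZero.pos N; omega)

theorem val_halfFreq (j : Fin (N / 2 + 1)) : (halfFreq N j : ℕ) = j := rfl

theorem exists_halfFreq_eq (k : Fin N) : ∃ j, halfFreq N j = k ∨ halfFreq N j = -k := by
  by_cases hk : 2 * (k : ℕ) ≤ N
  · exact ⟨⟨k, by omega⟩, .inl rfl⟩
  · refine ⟨⟨N - k, by omega⟩, .inr (Fin.ext ?_)⟩
    rw [val_halfFreq, Fin.val_neg, if_neg]
    rintro rfl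
    simp at hk

theorem halfFreq_eq_or_eq_neg_iff {i j : Fin (N / 2 + 1)} :
    halfFreq N i = halfFreq N j ∨ halfFreq N i = -halfFreq N j ↔ i = j := by
  refine ⟨?_, fun h => .inl (h ▸ rfl)⟩
  simp only [Fin.ext_iff, Fin.val_neg, val_halfFreq, Fin.val_zero]
  split_ifs <;> omega

theorem halfFreq_eq_neg_self_iff {j : Fin (N / 2 + 1)} :
    halfFreq N j = -halfFreq N j ↔ (j : ℕ) = 0 ∨ 2 * (j : ℕ) = N := by
  simp only [Fin.ext_iff, Fin.val_neg, val_halfFreq, Fin.val_zero]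
  split_ifs <;> omega

theorem eq_zero_of_dft_halfFreq_eq_zero {x : Fin N → ℝ} (h : ∀ j, dft N x (halfFreq N j) = 0) :
    x = 0 := by
  refine dft_injective N (funext fun k => ?_)
  rw [map_zero, Pi.zero_apply]
  obtain ⟨j, hj | hj⟩ := exists_halfFreq_eq k
  · rw [← hj, h]
  · rw [← neg_neg k, dft_neg, ← hj, h, map_zero]

theorem sum_halfFreq_blockDim (N : ℕ) [NeZero N] :
    ∑ j : Fin (N / 2 + 1), (if (j : ℕ) = 0 ∨ 2 * (j : ℕ) = N then 1 else 3) =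
      N + (N - 1) / 2 := by
  rw [Fin.sum_univ_eq_sum_range (fun j => if j = 0 ∨ 2 * j = N then 1 else 3)]
  obtain ⟨m, rfl | rfl⟩ := N.even_or_odd'
  · obtain ⟨m, rfl⟩ := Nat.exists_eq_succ_of_ne_zero (n := m) (by have := NeZero.ne (2 * m); omega)
    have middle : ∀ j ∈ Finset.range m,
        (if j + 1 = 0 ∨ 2 * (j + 1) = 2 * (m + 1) then 1 else 3) = 3 := fun j hj =>
      if_neg (by have := Finset.mem_range.1 hj; omega)
    rw [Nat.mul_div_cancel_left _ two_pos, Finset.sum_range_succ, Finset.sum_range_succ',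
      Finset.sum_congr rfl middle]
    simp
    omega
  · have tail : ∀ j ∈ Finset.range m,
        (if j + 1 = 0 ∨ 2 * (j + 1) = 2 * m + 1 then 1 else 3) = 3 := fun j _ =>
      if_neg (by omega)
    rw [show (2 * m + 1) / 2 + 1 = m + 1 by omega, Finset.sum_range_succ',
      Finset.sum_congr rfl tail]
    simp
    omega

theorem polyDimLE_orthogonalSpectra (N : ℕ) [NeZero N] :
    PolyDimLE ℝ (N + (N - 1) / 2) (orthogonalSpectra N) := by
  let half (j : Fin (N / 2 + 1)) : (Fin N → ℝ) →ₗ[ℝ] ℂ := LinearMap.proj (halfFreq N j) ∘ₗ dft N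
  let halves : (Fin N → ℝ) × (Fin N → ℝ) →ₗ[ℝ] (Fin (N / 2 + 1) → ℂ × ℂ) :=
    LinearMap.pi fun j => (half j).prodMap (half j)
  have hhalves : LinearMap.ker halves = ⊥ := by
    refine LinearMap.ker_eq_bot'.2 fun p hp => Prod.ext ?_ ?_
    · exact eq_zero_of_dft_halfFreq_eq_zero fun j => congrArg Prod.fst (congrFun hp j)
    · exact eq_zero_of_dft_halfFreq_eq_zero fun j => congrArg Prod.snd (congrFun hp j)
  obtain ⟨g, hg⟩ := halves.exists_leftInverse_of_injective hhalves
  have block : ∀ j : Fin (N / 2 + 1),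
      PolyDimLE ℝ (if (j : ℕ) = 0 ∨ 2 * (j : ℕ) = N then 1 else 3) {p : ℂ × ℂ |
        inner ℝ p.1 p.2 = 0 ∧ (halfFreq N j = -halfFreq N j → p.1.im = 0 ∧ p.2.im = 0)} := by
    intro j
    split_ifs with hj
    · exact polyDimLE_setOf_real_inner_eq_zero.mono fun p hp =>
        ⟨hp.1, hp.2 (halfFreq_eq_neg_self_iff.2 hj)⟩
    · exact polyDimLE_setOf_inner_eq_zero.mono fun p hp => hp.1
  have real : ∀ (x : Fin N → ℝ) (k : Fin N), k = -k → (dft N x k).im = 0 := fun x k hk =>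
    Complex.conj_eq_iff_im.1 (by rw [← dft_neg, ← hk])
  refine (((PolyDimLE.pi block).image (.linearMap_apply g)).le (sum_halfFreq_blockDim N).le).mono ?_
  intro p hp
  exact ⟨halves p, fun j _ => ⟨hp _, fun hj => ⟨real _ _ hj, real _ _ hj⟩⟩,
    LinearMap.congr_fun hg p⟩

theorem polyDimLE_scaledCollisions (N : ℕ) [NeZero N] :
    PolyDimLE ℝ (N + (N - 1) / 2 + 1) (scaledCollisions N) := by
  refine (((polyDimLE_orthogonalSpectra N).prod
    (.univ (Module.finrank_self ℝ).le)).image (Φ := fun q : ((Fin N → ℝ) × (Fin N → ℝ)) × ℝ =>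
      ((2⁻¹ : ℝ) • (q.1.1 + q.1.2), q.2 • (2⁻¹ : ℝ) • (q.1.1 - q.1.2))) (by fun_prop)).mono ?_
  rintro ⟨x, _⟩ ⟨e, y, hxy, rfl⟩
  refine ⟨((x + y, x - y), e), ⟨add_sub_mem_orthogonalSpectra_iff.2 hxy, trivial⟩, ?_⟩
  refine Prod.ext ?_ ?_ <;> dsimp only <;> module

theorem exists_dft_halfFreq_eq_single (N : ℕ) [NeZero N] :
    ∃ c : Fin (N / 2 + 1) → Fin N → ℝ, ∀ i j,
      dft N (c i) (halfFreq N j) = if j = i then 1 else 0 := by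
  have hermitian : ∀ i : Fin (N / 2 + 1), ∃ x, dft N x = fun k =>
      if k = halfFreq N i ∨ k = -halfFreq N i then 1 else 0 := fun i =>
    exists_dft_eq fun k => by
      simp only [neg_eq_iff_eq_neg, neg_neg, or_comm (a := k = -halfFreq N i)]
      split_ifs <;> simp
  choose c hc using hermitian
  exact ⟨c, fun i j => by simp only [hc, halfFreq_eq_or_eq_neg_iff]⟩

end HalfSpectrum

end Fourier

section SparseRecovery

theorem linearIndependent_add_sub {K E : Type*} [Field K] [NeZero (2 : K)] [AddCommGroup E]
    [Module K E] {x y : E} (h : LinearIndependent K ![x, y]) :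
    LinearIndependent K ![x + y, x - y] := by
  have hdet : (1 : K) * -1 ≠ 1 * 1 := fun h1 =>
    two_ne_zero (α := K) (by linear_combination -h1)
  simpa [sub_eq_add_neg] using (LinearIndependent.pair_add_smul_add_smul_iff 1 1 1 (-1)).2 ⟨h, hdet⟩

variable {N : ℕ} [NeZero N]

theorem thin_setOf_exists_not_SR1 :
    Thin ℝ {V : Fin N → Fin N → ℝ | ∃ M, 2 * M ≤ N / 2 + 2 ∧ ¬ SR1 V M} := by
  have bad : Thin ℝ {V : Fin N → Fin N → ℝ | ∃ S : Finset (Fin N), 2 * S.card ≤ N / 2 + 2 ∧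
      V ∈ Prod.fst '' incidence ℝ S S (orthogonalSpectra N)} := by
    refine .setOf_exists fun S => .setOf_and fun hS => ?_
    have := NeZero.pos N
    have := Nat.mul_pos this this
    exact (polyDimLE_fst_image_incidence (D := N * N - 1) (polyDimLE_orthogonalSpectra N)
      (fun c e _ _ _ => smul_mem_orthogonalSpectra c e) (by simp; omega)).thin
        (by simp [Module.finrank_pi_fintype]; omega)
  refine bad.mono ?_
  rintro V ⟨_, hM, hSR⟩
  contrapose! hSR
  rintro S rfl x hx y hy
  refine ⟨fun hxy => (eqUpToSign_or_linearIndependent hxy).resolve_right fun hli => hSR ?_,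
    EqUpToSign.powerSpectrum_eq⟩
  exact ⟨S, hM, (V, x + y), ⟨add_mem hx hy, x - y, sub_mem hx hy,
    add_sub_mem_orthogonalSpectra_iff.2 hxy, linearIndependent_add_sub hli⟩, rfl⟩

theorem eqUpToSign_or_mem_incidence {V : Fin N → Fin N → ℝ} {S₁ S₂ : Finset (Fin N)}
    {x y : Fin N → ℝ} (hx : x ∈ L V S₁) (hy : y ∈ L V S₂)
    (hxy : powerSpectrum x = powerSpectrum y) :
    EqUpToSign x y ∨ (V, x) ∈ incidence ℝ S₁ S₂ (scaledCollisions N) :=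
  (eqUpToSign_or_linearIndependent hxy).imp_right fun hli =>
    ⟨hx, y, hy, ⟨1, y, hxy, (one_smul ℝ y).symm⟩, hli⟩

theorem EqUpToSign.mem {N : ℕ} {x y : Fin N → ℝ} (h : EqUpToSign x y)
    {W : Submodule ℝ (Fin N → ℝ)} (hy : y ∈ W) : x ∈ W := by
  obtain ⟨t, -, rfl⟩ := h
  exact W.smul_mem t hy

theorem thin_setOf_exists_not_SR2 :
    Thin ℝ {V : Fin N → Fin N → ℝ | ∃ M, 2 * M ≤ N / 2 + 1 ∧ ¬ SR2 V M} := by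
  have bad : Thin ℝ {V : Fin N → Fin N → ℝ | ∃ S₁ S₂ : Finset (Fin N),
      S₁.card + S₂.card ≤ N / 2 + 1 ∧
      V ∈ Prod.fst '' incidence ℝ S₁ S₂ (scaledCollisions N)} := by
    refine .setOf_exists fun S₁ => .setOf_exists fun S₂ => .setOf_and fun hS => ?_
    have := NeZero.pos N
    have := Nat.mul_pos this this
    exact (polyDimLE_fst_image_incidence (D := N * N - 1) (polyDimLE_scaledCollisions N)
      (fun c e hc _ _ => smul_mem_scaledCollisions hc e) (by simp; omega)).thin
        (by simp [Module.finrank_pi_fintype]; omega)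
  refine bad.mono ?_
  rintro V ⟨M, hM, hSR⟩
  contrapose! hSR
  intro S₁ S₂ h₁ h₂ _
  refine Set.Subset.antisymm ?_ (Set.image_inter_subset _ _ _)
  rintro _ ⟨⟨x, hx, rfl⟩, ⟨y, hy, hyx⟩⟩
  rcases eqUpToSign_or_mem_incidence hx hy hyx.symm with hsign | hinc
  · exact ⟨x, ⟨hx, hsign.mem hy⟩, rfl⟩
  · exact absurd ⟨S₁, S₂, by omega, (V, x), hinc, rfl⟩ hSR

/-- A set of vectors is spectrally negligible for a subspace if some polynomial function of the
power spectrum vanishes on the set, but not on the whole subspace. -/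
def SpectrallyNegligible {N : ℕ} (B : Set (Fin N → ℝ)) (W : Submodule ℝ (Fin N → ℝ)) : Prop :=
  ∃ g : (Fin N → ℝ) → ℝ, IsPolyMap ℝ g ∧ (∀ x ∈ B, g (powerSpectrum x) = 0) ∧
    ∃ x ∈ W, g (powerSpectrum x) ≠ 0

theorem exists_powerSpectrum_sum_smul_eq_sq {S : Finset (Fin N)} (hS : S.card ≤ N / 2 + 1) :
    ∃ (f : S → Fin N) (V : Fin N → Fin N → ℝ), ∀ (a : S → ℝ) (j : S),
      powerSpectrum (∑ l, a l • V l) (f j) = a j ^ 2 := by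
  obtain ⟨e⟩ : Nonempty (S ↪ Fin (N / 2 + 1)) :=
    Function.Embedding.nonempty_of_card_le (by simpa using hS)
  obtain ⟨c, hc⟩ := exists_dft_halfFreq_eq_single N
  refine ⟨fun l => halfFreq N (e l), Function.extend Subtype.val (c ∘ e) 0, fun a j => ?_⟩
  simp [powerSpectrum_apply, hc]

/-- On `L V S`, for generic `V`, the power spectra at `#S` frequencies that are pairwise not
conjugate are algebraically independent: for a suitable `V` they are the squares of the
coordinates. -/
theorem thin_setOf_not_spectrallyNegligible {S : Finset (Fin N)} (hS : S.card ≤ N / 2 + 1) {D : ℕ}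
    {B : Set ((Fin N → Fin N → ℝ) × (Fin N → ℝ))} (hB : PolyDimLE ℝ D B)
    (hD : D < N * N + S.card) :
    Thin ℝ {V | ¬ SpectrallyNegligible {x | (V, x) ∈ B} (L V S)} := by
  obtain ⟨f, V₀, hV₀⟩ := exists_powerSpectrum_sum_smul_eq_sq hS
  let G (p : (Fin N → Fin N → ℝ) × (S → ℝ)) : S → ℝ :=
    fun j => powerSpectrum (∑ l, p.2 l • p.1 l) (f j)
  have hsample : IsPolyMap ℝ fun p : Fin N → ℝ => fun j : S => p (f j) := by fun_prop
  have hG : IsPolyMap ℝ G := hsample.comp (isPolyMap_powerSpectrum.comp (by fun_prop))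
  have hG₀ : (fun a => G (V₀, a)) = fun a => a ^ 2 := funext fun a => funext fun j => hV₀ a j
  have hderiv : HasFDerivAt (fun a => G (V₀, a))
      ((2 : ℝ) • ContinuousLinearMap.id ℝ (S → ℝ)) 1 := by
    rw [hG₀]
    refine (hasFDerivAt_pow 2).congr_fderiv ?_
    ext
    simp
  have hsurj : Function.Surjective ((2 : ℝ) • ContinuousLinearMap.id ℝ (S → ℝ)) := fun a =>
    ⟨(2⁻¹ : ℝ) • a, by simp⟩
  obtain ⟨Q, hQ, hQ0, hQB⟩ := (hB.image (Φ := fun p => (p.1, fun j : S => powerSpectrum p.2 (f j)))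
    ((IsPolyMap.fst .id).prodMk (hsample.comp (isPolyMap_powerSpectrum.comp (.snd .id))))).thin
    (by simpa [Module.finrank_pi_fintype] using hD)
  obtain ⟨V₁, a, hne⟩ := hG.exists_graph_ne_zero hderiv hsurj hQ hQ0
  have hslice : IsPolyMap ℝ fun V => Q (V, G (V, a)) :=
    hQ.comp (.prodMk .id (hG.comp (by fun_prop)))
  refine ⟨_, hslice, fun h => hne (congrFun h V₁), fun V hV => by_contra fun hVa => hV ?_⟩
  have hmem : ∑ l, a l • V l ∈ L V S :=
    sum_mem fun l _ => Submodule.smul_mem _ _ (Submodule.subset_span ⟨l, l.2, rfl⟩)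
  exact ⟨fun p => Q (V, fun j => p (f j)), hQ.comp (by fun_prop),
    fun x hx => hQB _ ⟨(V, x), hx, rfl⟩, _, hmem, hVa⟩

theorem polyDimLE_incidence_scaledCollisions {S₁ S₂ : Finset (Fin N)}
    (hS₂ : S₂.card ≤ N / 2) :
    PolyDimLE ℝ (N * N + S₁.card - 1) (incidence ℝ S₁ S₂ (scaledCollisions N)) := by
  have := NeZero.pos N
  have := Nat.mul_pos this this
  exact polyDimLE_incidence (polyDimLE_scaledCollisions N)
    (fun c e hc _ _ => smul_mem_scaledCollisions hc e) (by simp; omega)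

theorem thin_setOf_exists_not_SR1g :
    Thin ℝ {V : Fin N → Fin N → ℝ | ∃ M ≤ N / 2, ¬ SR1g V M} := by
  have bad : Thin ℝ {V : Fin N → Fin N → ℝ | ∃ S : Finset (Fin N), S.card ≤ N / 2 ∧
      ¬ SpectrallyNegligible {x | (V, x) ∈ incidence ℝ S S (scaledCollisions N)} (L V S)} := by
    have := NeZero.pos N
    have := Nat.mul_pos this this
    exact .setOf_exists fun S => .setOf_and fun hS => thin_setOf_not_spectrallyNegligible
      (by omega) (polyDimLE_incidence_scaledCollisions hS) (by omega)
  refine bad.mono ?_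
  rintro V ⟨_, hM, hSR⟩
  contrapose! hSR
  simp only [Set.mem_ofPred_eq, not_exists, not_and, not_not] at hSR
  rintro S rfl
  obtain ⟨g, hg, hgB, x₀, hx₀, hgx₀⟩ := hSR S hM
  refine ⟨_, isRealAlgebraic_setOf_eq_zero (hg.comp isPolyMap_powerSpectrum), ⟨x₀, hx₀, hgx₀⟩, ?_⟩
  rintro x ⟨hx, hgx⟩ y hy
  exact ⟨fun hxy => (eqUpToSign_or_mem_incidence hx hy hxy).resolve_right
    fun hinc => hgx (hgB x hinc), EqUpToSign.powerSpectrum_eq⟩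

theorem card_inter_lt {α : Type*} [DecidableEq α] {s t : Finset α} (hcard : s.card = t.card)
    (hne : s ≠ t) : (s ∩ t).card < s.card := by
  refine Finset.card_lt_card (Finset.inter_subset_left.ssubset_of_ne fun h => hne ?_)
  exact Finset.eq_of_subset_of_card_le (Finset.inter_eq_left.1 h) hcard.ge

theorem thin_setOf_exists_not_SR2g :
    Thin ℝ {V : Fin N → Fin N → ℝ | LinearIndependent ℝ V ∧ ∃ M ≤ N / 2, ¬ SR2g V M} := by
  have bad : Thin ℝ {V : Fin N → Fin N → ℝ | ∃ S₁ S₂ : Finset (Fin N),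
      (S₁.card ≤ N / 2 ∧ S₁.card = S₂.card ∧ S₁ ≠ S₂) ∧
      ¬ SpectrallyNegligible {x | (V, x) ∈ incidence ℝ S₁ S₂ (scaledCollisions N) ∪
        {p | p.2 ∈ L p.1 (S₁ ∩ S₂)}} (L V S₁)} := by
    refine .setOf_exists fun S₁ => .setOf_exists fun S₂ => .setOf_and fun ⟨hS, hcard, hne⟩ => ?_
    have := NeZero.pos N
    have := Nat.mul_pos this this
    have := card_inter_lt hcard hne
    refine thin_setOf_not_spectrallyNegligible (D := N * N + S₁.card - 1) (by omega) ?_ (by omega)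
    exact (polyDimLE_incidence_scaledCollisions (hcard ▸ hS)).union
      ((polyDimLE_setOf_mem_span (S₁ ∩ S₂)).le (by simp; omega))
  refine bad.mono ?_
  rintro V ⟨hV, M, hM, hSR⟩
  contrapose! hSR
  simp only [Set.mem_ofPred_eq, not_exists, not_and, not_not] at hSR
  rintro S₁ S₂ rfl hcard hne
  obtain ⟨g, hg, hgB, x₀, hx₀, hgx₀⟩ := hSR S₁ S₂ ⟨hM, hcard.symm, hne⟩
  refine ⟨_, isRealAlgebraic_setOf_eq_zero hg, ?_, Set.inter_subset_left, fun h =>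
    hgx₀ (h ⟨x₀, hx₀, rfl⟩).2⟩
  rintro _ ⟨⟨x, hx, rfl⟩, ⟨y, hy, hyx⟩⟩
  refine ⟨⟨x, hx, rfl⟩, hgB x ?_⟩
  rcases eqUpToSign_or_mem_incidence hx hy hyx.symm with hsign | hinc
  · refine .inr ?_
    rw [Set.mem_ofPred_eq, L, Finset.coe_inter, span_image_inter hV]
    exact ⟨hx, hsign.mem hy⟩
  · exact .inl hinc

end SparseRecovery

theorem SR1_SR2_SR1g_SR2g_of_dim_zero (V : Fin 0 → Fin 0 → ℝ) (M : ℕ) :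
    SR1 V M ∧ SR2 V M ∧ SR1g V M ∧ SR2g V M := by
  have hSR1 (x y : Fin 0 → ℝ) : powerSpectrum x = powerSpectrum y ↔ EqUpToSign x y :=
    iff_of_true (Subsingleton.elim _ _) ⟨1, norm_one, Subsingleton.elim _ _⟩
  refine ⟨fun _ _ x _ y _ => hSR1 x y, fun S₁ S₂ _ _ hne => absurd (Subsingleton.elim S₁ S₂) hne,
    fun S _ => ?_, fun S₁ S₂ _ _ hne => absurd (Subsingleton.elim S₁ S₂) hne⟩
  exact ⟨_, isRealAlgebraic_setOf_eq_zero (.const 1), ⟨0, zero_mem _, one_ne_zero⟩,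
    fun x _ y _ => hSR1 x y⟩

end SparsePhase

theorem mainTheorem1 (N : ℕ) :
    SparsePhase.ForGenericBasis N fun V => ∀ M : ℕ,
      ((Even N ∧ (N : ℤ) > 4 * (M : ℤ) - 6 ∨ Odd N ∧ (N : ℤ) > 4 * (M : ℤ) - 5) →
        SparsePhase.SR1 V M) ∧
      ((Even N ∧ (N : ℤ) > 4 * (M : ℤ) - 4 ∨ Odd N ∧ (N : ℤ) > 4 * (M : ℤ) - 3) →
        SparsePhase.SR2 V M) ∧
      ((Even N ∧ (N : ℤ) > 2 * (M : ℤ) - 2 ∨ Odd N ∧ (N : ℤ) > 2 * (M : ℤ) - 1) →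
        SparsePhase.SR1g V M ∧ SparsePhase.SR2g V M) := by
  open SparsePhase in
  rcases eq_zero_or_neZero N with rfl | _
  · refine forGenericBasis_of_thin ((Thin.empty ℝ _).mono fun V ⟨_, hV⟩ => hV fun M => ?_)
    obtain ⟨h₁, h₂, h₁g, h₂g⟩ := SR1_SR2_SR1g_SR2g_of_dim_zero V M
    exact ⟨fun _ => h₁, fun _ => h₂, fun _ => ⟨h₁g, h₂g⟩⟩
  · refine forGenericBasis_of_thin (((thin_setOf_exists_not_SR1.union
      thin_setOf_exists_not_SR2).union (thin_setOf_exists_not_SR1g.union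
      thin_setOf_exists_not_SR2g)).mono ?_)
    rintro V ⟨hV, hneg⟩
    contrapose! hneg
    simp only [Set.mem_union, Set.mem_ofPred_eq, not_or, not_exists, not_and, not_not] at hneg
    obtain ⟨⟨h₁, h₂⟩, h₁g, h₂g⟩ := hneg
    simp only [Nat.even_iff, Nat.odd_iff]
    exact fun M => ⟨fun hM => h₁ M (by omega), fun hM => h₂ M (by omega),
      fun hM => ⟨h₁g M (by omega), h₂g hV M (by omega)⟩⟩
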